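/- For a finite simple graph $G$ and a positive integer $t$, let $i_t(G)$ denote the number of independent sets of size $t$ in $G$. A graph $G$ is called $K_n$-covered if every vertex of $G$ is contained in at least one copy of the complete graph $K_n$ in $G$. For integers $N \ge k \ge 0$, let $S_{N,k} = K_k \vee \overline{K_{N-k}}$ be the join of the complete graph on $k$ vertices and the empty graph on $N-k$ vertices. Let $n, t, N$ be positive integers with $t \ge 3$ and $N \ge n$. Then every $K_n$-covered graph $G$ on $N$ vertices satisfies $$i_t(G) \le \binom{N-n+1}{t}.$$ Moreover, if $N \ge n+t-1$, then $S_{N,n-1}$ is the unique extremal graph: a graph $G$ on $N$ vertices is $K_n$-covered and satisfies $i_t(G) = \binom{N-n+1}{t}$ if and only if $G$ is isomorphic to $S_{N,n-1}$. -/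

import Mathlib

namespace SimpleGraph

/-- `G` is `H`-covered: every vertex of `G` lies in a (not necessarily induced) copy of `H`
in `G`. -/
def IsCoveredBy {V W : Type*} (G : SimpleGraph V) (H : SimpleGraph W) : Prop :=
  ∀ v : V, ∃ f : Copy H G, v ∈ Set.range f

/-- The join `G ∨ H`: the disjoint union of `G` and `H` together with all edges between them. -/
def joinGraph {V W : Type*} (G : SimpleGraph V) (H : SimpleGraph W) : SimpleGraph (V ⊕ W) :=
  (G ⊕g H) ⊔ completeBipartiteGraph V W

/-- `S_{N,k}`: the join of the complete graph on `k` vertices and the empty graph on `N - k`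
vertices (used for `k ≤ N`). -/
def splitGraph (N k : ℕ) : SimpleGraph (Fin k ⊕ Fin (N - k)) :=
  joinGraph (completeGraph (Fin k)) (emptyGraph (Fin (N - k)))

/-- `i_t(G)`: the number of independent sets of size `t` in `G`. -/
def indepCount {V : Type*} [Fintype V] [DecidableEq V] (G : SimpleGraph V) [DecidableRel G.Adj]
    (t : ℕ) : ℕ :=
  (G.indepSetFinset t).card

end SimpleGraph

/-! Induct on a family of `n`-cliques with union `U`, removing the clique `A` whose private part `P`
(vertices in no other member) is smallest; let `p = #P`. Independent `t`-sets avoiding `P` live in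
the union of the other cliques. One through `v ∈ P` has its remaining `t - 1` vertices in `U \ A`;
let `x` count the independent `(t - 1)`-sets there.

By minimality every other clique keeps at least `p` vertices outside `A`, so double counting bounds
`x` (`mul_card_indepSetsIn_le`). Then `Nat.choose_add_mul_le_choose` closes the induction, strictly
if `p ≥ 2`. Equality forces `p = 1` and makes `{v} ∪ (U \ A)` independent, which determines the
graph. -/

theorem Nat.add_mul_choose_le_mul_choose_add (q j k : ℕ) :
    (q + j) * q.choose (k + 1) ≤ q * (q + j).choose (k + 1) := by
  rcases q with _ | q
  · simp
  · have h₁ := Nat.add_one_mul_choose_eq q k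
    have h₂ := Nat.add_one_mul_choose_eq (q + j) k
    have h₃ : q.choose k ≤ (q + j).choose k := Nat.choose_le_choose k (Nat.le_add_right q j)
    have e : q + 1 + j = q + j + 1 := by ring
    rw [e]
    refine Nat.le_of_mul_le_mul_right (c := k + 1) ?_ k.succ_pos
    calc (q + j + 1) * (q + 1).choose (k + 1) * (k + 1)
        = (q + j + 1) * ((q + 1) * q.choose k) := by rw [h₁, mul_assoc]
      _ ≤ (q + j + 1) * ((q + 1) * (q + j).choose k) := by gcongr
      _ = (q + 1) * ((q + j + 1) * (q + j).choose k) := by ring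
      _ = (q + 1) * (q + j + 1).choose (k + 1) * (k + 1) := by rw [h₂, mul_assoc]

/-- Telescoping: `3pq(p + q) + p³ - p` is the sum of `3(q + i)(q + i + 1)` over `i < p`, and each
summand is absorbed by one Pascal step because `m ↦ m.choose (k + 1) / m` is nondecreasing. A lower
index of at least 1 is essential here, hence `t ≥ 3`. The surplus `p³ - p` yields strictness for `p
≥ 2`. -/
theorem Nat.choose_mul_cubic_le (q p k : ℕ) :
    q.choose (k + 1) * (3 * p * q * (p + q) + p ^ 3)
        + 3 * q * (k + 2) * (q + 1).choose (k + 3) ≤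
      3 * q * (k + 2) * (p + q + 1).choose (k + 3) + q.choose (k + 1) * p := by
  induction p with
  | zero => simp
  | succ p ih =>
    have h₁ : (p + 1 + q + 1).choose (k + 3) =
        (p + q + 1).choose (k + 2) + (p + q + 1).choose (k + 3) := by
      rw [show p + 1 + q + 1 = (p + q + 1) + 1 by ring, Nat.choose_succ_succ]
    have h₂ := Nat.add_one_mul_choose_eq (p + q) (k + 1)
    have h₃ := Nat.mul_le_mul_left (3 * (p + q + 1)) (Nat.add_mul_choose_le_mul_choose_add q p k)
    rw [add_comm q p] at h₃
    have h₄ : 3 * q * (k + 2) * (p + q + 1).choose (k + 2)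
        = 3 * (p + q + 1) * (q * (p + q).choose (k + 1)) := by
      calc _ = 3 * q * ((p + q + 1).choose (k + 1 + 1) * (k + 1 + 1)) := by ring
        _ = _ := by rw [← h₂]; ring
    rw [h₁, mul_add (3 * q * (k + 2)), h₄]
    nlinarith

/-- Replacing `p` copies of a count `x` by the binomial increment. -/
theorem Nat.choose_add_mul_le_choose {L p k x : ℕ}
    (hx : (k + 2) * x ≤ L * (L - p).choose (k + 1)) :
    (L + 1 - p).choose (k + 3) + p * x ≤ (L + 1).choose (k + 3) ∧
    (2 ≤ p → k + 3 ≤ L + 1 → (L + 1 - p).choose (k + 3) + p * x < (L + 1).choose (k + 3)) := by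
  by_cases hk : L - p < k + 1
  · have hx₀ : x = 0 := by
      rw [Nat.choose_eq_zero_of_lt hk] at hx
      simpa using hx
    subst hx₀
    rw [Nat.choose_eq_zero_of_lt (by omega : L + 1 - p < k + 3)]
    exact ⟨by simp, fun _ h ↦ by simpa using Nat.choose_pos h⟩
  · obtain ⟨q, rfl⟩ : ∃ q, L = p + q := ⟨L - p, by omega⟩
    rw [show p + q + 1 - p = q + 1 by omega]
    rw [show p + q - p = q by omega] at hk hx
    have hq : 0 < q := by omega
    have hc : 0 < q.choose (k + 1) := Nat.choose_pos (by omega)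
    have h := Nat.choose_mul_cubic_le q p k
    have hm := Nat.mul_le_mul_left (3 * q * p) hx
    have hpos : 0 < 3 * q * (k + 2) := by positivity
    constructor
    · refine Nat.le_of_mul_le_mul_left ?_ hpos
      have : q.choose (k + 1) * p ≤ q.choose (k + 1) * p ^ 3 :=
        Nat.mul_le_mul_left _ (Nat.le_self_pow (by norm_num) p)
      nlinarith
    · intro hp _
      refine Nat.lt_of_mul_lt_mul_left (a := 3 * q * (k + 2)) ?_
      have : q.choose (k + 1) * p < q.choose (k + 1) * p ^ 3 := by
        refine Nat.mul_lt_mul_of_pos_left ?_ hc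
        simpa using Nat.pow_lt_pow_right (by omega : 1 < p) (by norm_num : 1 < 3)
      nlinarith

namespace SimpleGraph

open Finset

variable {V : Type*}

/-! ### Clique covers and split graphs -/

section

variable [DecidableEq V] {G : SimpleGraph V}

theorem isCoveredBy_completeGraph_iff {n : ℕ} :
    G.IsCoveredBy (completeGraph (Fin n)) ↔ ∀ v, ∃ A : Finset V, v ∈ A ∧ G.IsNClique n A := by
  refine forall_congr' fun v ↦ ⟨?_, ?_⟩
  · rintro ⟨f, i, rfl⟩
    refine ⟨univ.image f, mem_image_of_mem _ (mem_univ i), ?_, ?_⟩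
    · rintro _ ha _ hb hab
      simp only [coe_image, coe_univ, Set.image_univ, Set.mem_range] at ha hb
      obtain ⟨a, rfl⟩ := ha
      obtain ⟨b, rfl⟩ := hb
      refine f.toHom.map_adj ?_
      rintro rfl
      exact hab rfl
    · exact (card_image_of_injective _ f.injective).trans (by simp)
  · rintro ⟨A, hvA, hA⟩
    have e := (A.equivFinOfCardEq hA.card_eq).symm
    refine ⟨⟨⟨fun i ↦ (e i : V), ?_⟩, ?_⟩, e.symm ⟨v, hvA⟩, ?_⟩
    · intro a b hab
      exact hA.isClique (e a).2 (e b).2 fun h ↦ hab (e.injective (Subtype.ext h))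
    · intro a b hab
      exact e.injective (Subtype.ext hab)
    · change ((e (e.symm ⟨v, hvA⟩) : A) : V) = v
      simp

theorem splitGraph_adj {N k : ℕ} (x y : Fin k ⊕ Fin (N - k)) :
    (splitGraph N k).Adj x y ↔ x ≠ y ∧ ¬ (x.isRight ∧ y.isRight) := by
  rcases x with x | x <;> rcases y with y | y <;>
    simp [splitGraph, joinGraph, completeGraph, emptyGraph]

variable [Fintype V]

theorem nonempty_iso_splitGraph_iff {k : ℕ} (hk : k ≤ Fintype.card V) :
    Nonempty (G ≃g splitGraph (Fintype.card V) k) ↔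
      ∃ I : Finset V, #I = Fintype.card V - k ∧
        ∀ u w, G.Adj u w ↔ u ≠ w ∧ ¬ (u ∈ I ∧ w ∈ I) := by
  constructor
  · rintro ⟨φ⟩
    refine ⟨univ.image fun j ↦ φ.symm (Sum.inr j), ?_, fun u w ↦ ?_⟩
    · exact (card_image_of_injective _ (φ.symm.injective.comp Sum.inr_injective)).trans (by simp)
    · have hmem : ∀ u, u ∈ univ.image (fun j ↦ φ.symm (Sum.inr j)) ↔ (φ u).isRight := by
        intro u
        simp only [mem_image, mem_univ, true_and, Sum.isRight_iff]
        refine exists_congr fun j ↦ ⟨?_, fun h ↦ ?_⟩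
        · rintro rfl
          simp
        · rw [← h]
          simp
      rw [hmem, hmem, ← φ.map_adj_iff, splitGraph_adj, φ.injective.ne_iff]
  · rintro ⟨I, hI, hadj⟩
    have hIc : Fintype.card {v // ¬ v ∉ I} = Fintype.card V - k := by
      simp [hI]
    have hI' : Fintype.card {v // v ∉ I} = k := by
      rw [Fintype.card_subtype_compl]
      simp only [Fintype.card_coe, hI]
      omega
    let e : V ≃ Fin k ⊕ Fin (Fintype.card V - k) :=
      (Equiv.sumCompl (· ∉ I)).symm.trans
        ((Fintype.equivFinOfCardEq hI').sumCongr (Fintype.equivFinOfCardEq hIc))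
    have he : ∀ v, (e v).isRight ↔ v ∈ I := by
      intro v
      by_cases hv : v ∈ I
      · have : ¬ v ∉ I := by simpa using hv
        simp [e, Equiv.sumCompl_symm_apply_of_neg (p := (· ∉ I)) this, hv]
      · simp [e, Equiv.sumCompl_symm_apply_of_pos (p := (· ∉ I)) hv, hv]
    refine ⟨⟨e, fun {u w} ↦ ?_⟩⟩
    rw [splitGraph_adj, he, he, hadj, e.injective.ne_iff]

/-- A `K_n`-covered graph with an independent set of the maximal size is a split graph. -/
theorem adj_iff_of_indep {n : ℕ} {I : Finset V}
    (hcov : ∀ v, ∃ A : Finset V, v ∈ A ∧ G.IsNClique n A)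
    (hI : #I + n = Fintype.card V + 1) (hind : ∀ u ∈ I, ∀ w ∈ I, ¬ G.Adj u w) (hne : I.Nonempty)
    (u w : V) : G.Adj u w ↔ u ≠ w ∧ ¬ (u ∈ I ∧ w ∈ I) := by
  have hcompl : ∀ v ∈ I, ∃ A : Finset V, v ∈ A ∧ Iᶜ ⊆ A ∧ G.IsClique A := by
    intro v hv
    obtain ⟨A, hvA, hA⟩ := hcov v
    refine ⟨A, hvA, ?_, hA.isClique⟩
    -- A clique meets `I` at most once, so the other `n - 1` vertices of `A` fill `Iᶜ`, which has
    -- exactly `n - 1` elements.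
    have hsub : A.erase v ⊆ Iᶜ := by
      intro x hx
      rw [mem_erase] at hx
      exact mem_compl.2 fun hxI ↦ hind v hv x hxI (hA.isClique hvA hx.2 hx.1.symm)
    rw [← eq_of_subset_of_card_le hsub]
    · exact erase_subset _ _
    · rw [card_erase_of_mem hvA, hA.card_eq, card_compl]
      omega
  have key : ∀ u w, u ≠ w → w ∉ I → G.Adj u w := by
    intro u w huw hw
    by_cases hu : u ∈ I
    · obtain ⟨A, huA, hA, hc⟩ := hcompl u hu
      exact hc huA (hA (mem_compl.2 hw)) huw
    · obtain ⟨v, hv⟩ := hne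
      obtain ⟨A, -, hA, hc⟩ := hcompl v hv
      exact hc (hA (mem_compl.2 hu)) (hA (mem_compl.2 hw)) huw
  refine ⟨fun h ↦ ⟨h.ne, fun ⟨hu, hw⟩ ↦ hind u hu w hw h⟩, fun ⟨huw, h⟩ ↦ ?_⟩
  by_cases hw : w ∈ I
  · exact (key w u huw.symm fun hu ↦ h ⟨hu, hw⟩).symm
  · exact key u w huw hw

theorem exists_isNClique_of_adj_iff {n : ℕ} {I : Finset V}
    (hI : #I + n = Fintype.card V + 1) (hne : I.Nonempty)
    (hadj : ∀ u w, G.Adj u w ↔ u ≠ w ∧ ¬ (u ∈ I ∧ w ∈ I)) (v : V) :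
    ∃ A : Finset V, v ∈ A ∧ G.IsNClique n A := by
  have key : ∀ x ∈ I, G.IsNClique n (insert x Iᶜ) := by
    intro x hx
    refine ⟨fun a ha b hb hab ↦ (hadj a b).2 ⟨hab, fun ⟨haI, hbI⟩ ↦ hab ?_⟩, ?_⟩
    · simp only [coe_insert, coe_compl, Set.mem_insert_iff, Set.mem_compl_iff, mem_coe] at ha hb
      rw [ha.resolve_right (not_not.2 haI), hb.resolve_right (not_not.2 hbI)]
    · rw [card_insert_of_notMem (by simpa using hx), card_compl]
      have := card_le_univ I
      omega
  by_cases hv : v ∈ I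
  · exact ⟨_, mem_insert_self v _, key v hv⟩
  · obtain ⟨x, hx⟩ := hne
    exact ⟨_, mem_insert_of_mem (mem_compl.2 hv), key x hx⟩

end

/-- The independent sets of size `t` of `G` contained in `W`. -/
def indepSetsIn (G : SimpleGraph V) [DecidableRel G.Adj] (W : Finset V) (t : ℕ) :
    Finset (Finset V) :=
  {S ∈ W.powersetCard t | ∀ u ∈ S, ∀ w ∈ S, ¬ G.Adj u w}

/-! ### Counting independent sets inside a vertex set -/

variable {G : SimpleGraph V} [DecidableRel G.Adj]

theorem mem_indepSetsIn {W S : Finset V} {t : ℕ} :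
    S ∈ G.indepSetsIn W t ↔ S ⊆ W ∧ #S = t ∧ ∀ u ∈ S, ∀ w ∈ S, ¬ G.Adj u w := by
  simp [indepSetsIn, and_assoc]

theorem card_indepSetsIn_le_choose (W : Finset V) (t : ℕ) :
    #(G.indepSetsIn W t) ≤ (#W).choose t :=
  (card_filter_le _ _).trans_eq (card_powersetCard t W)

variable [DecidableEq V]

theorem card_filter_mem_indepSetsIn_le {W Q : Finset V} {v : V} {k : ℕ} (hv : v ∈ Q)
    (hQ : G.IsClique Q) :
    #{S ∈ G.indepSetsIn W (k + 1) | v ∈ S} ≤ #(G.indepSetsIn (W \ Q) k) := by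
  refine card_le_card_of_injOn (fun S ↦ S.erase v) ?_ ?_
  · intro S hS
    simp only [coe_filter, Set.mem_ofPred_eq, mem_indepSetsIn] at hS
    obtain ⟨⟨hSW, hc, hind⟩, hvS⟩ := hS
    simp only [SetLike.mem_coe, mem_indepSetsIn]
    refine ⟨fun u hu ↦ ?_, by rw [card_erase_of_mem hvS, hc]; rfl,
      fun u hu w hw ↦ hind u (mem_of_mem_erase hu) w (mem_of_mem_erase hw)⟩
    rw [mem_erase] at hu
    exact mem_sdiff.2 ⟨hSW hu.2, fun huQ ↦ hind v hvS u hu.2 (hQ hv huQ hu.1.symm)⟩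
  · intro S hS T hT h
    simp only [coe_filter, Set.mem_ofPred_eq] at hS hT
    rw [← insert_erase hS.2, ← insert_erase hT.2]
    exact congrArg (insert v) h

/-- If `W` is covered by cliques of size at least `p`, independent sets are few. -/
theorem mul_card_indepSetsIn_le {W : Finset V} {p k : ℕ}
    (h : ∀ u ∈ W, ∃ Q ⊆ W, u ∈ Q ∧ p ≤ #Q ∧ G.IsClique Q) :
    (k + 1) * #(G.indepSetsIn W (k + 1)) ≤ #W * (#W - p).choose k := by
  -- Double count pairs (vertex, independent set containing it).
  have hcount : (k + 1) * #(G.indepSetsIn W (k + 1)) =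
      ∑ u ∈ W, #{S ∈ G.indepSetsIn W (k + 1) | u ∈ S} := by
    have := sum_card_bipartiteAbove_eq_sum_card_bipartiteBelow
      (s := W) (t := G.indepSetsIn W (k + 1)) (fun u S ↦ u ∈ S)
    simp only [bipartiteAbove, bipartiteBelow] at this
    rw [this, mul_comm, ← smul_eq_mul, ← sum_const]
    refine sum_congr rfl fun S hS ↦ ?_
    rw [mem_indepSetsIn] at hS
    rw [filter_mem_eq_inter, inter_eq_right.2 hS.1, hS.2.1]
  rw [hcount, ← smul_eq_mul, ← sum_const]
  refine sum_le_sum fun u hu ↦ ?_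
  obtain ⟨Q, hQW, huQ, hp, hQ⟩ := h u hu
  refine (card_filter_mem_indepSetsIn_le huQ hQ).trans
    ((card_indepSetsIn_le_choose _ _).trans (Nat.choose_le_choose k ?_))
  rw [card_sdiff_of_subset hQW]
  omega

theorem card_indepSetsIn_le_add_sum (U P : Finset V) (t : ℕ) :
    #(G.indepSetsIn U t) ≤
      #(G.indepSetsIn (U \ P) t) + ∑ v ∈ P, #{S ∈ G.indepSetsIn U t | v ∈ S} := by
  have hsub : G.indepSetsIn U t ⊆
      G.indepSetsIn (U \ P) t ∪ P.biUnion fun v ↦ {S ∈ G.indepSetsIn U t | v ∈ S} := by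
    intro S hS
    by_cases h : ∃ v ∈ P, v ∈ S
    · obtain ⟨v, hvP, hvS⟩ := h
      exact mem_union_right _ (mem_biUnion.2 ⟨v, hvP, mem_filter.2 ⟨hS, hvS⟩⟩)
    · push Not at h
      refine mem_union_left _ ?_
      rw [mem_indepSetsIn] at hS ⊢
      exact ⟨fun u hu ↦ mem_sdiff.2 ⟨hS.1 hu, fun huP ↦ h u huP hu⟩, hS.2⟩
  exact (card_le_card hsub).trans ((card_union_le _ _).trans
    (Nat.add_le_add_left card_biUnion_le _))

/-- If the count through `v` is the largest possible, `v` together with any `(k + 2)`-subset of `W`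
is independent, and such sets contain every pair from `insert v W`. -/
theorem indep_insert_of_choose_le {W U : Finset V} {v : V} {k : ℕ} (hk : k + 2 ≤ #W)
    (hW : ∀ S ∈ G.indepSetsIn U (k + 3), v ∈ S → S.erase v ⊆ W)
    (h : (#W).choose (k + 2) ≤ #{S ∈ G.indepSetsIn U (k + 3) | v ∈ S}) :
    ∀ u ∈ insert v W, ∀ w ∈ insert v W, ¬ G.Adj u w := by
  have hsub : {S ∈ G.indepSetsIn U (k + 3) | v ∈ S} ⊆ (W.powersetCard (k + 2)).image (insert v) := by
    intro S hS
    rw [mem_filter] at hS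
    refine mem_image.2 ⟨S.erase v, mem_powersetCard.2 ⟨hW S hS.1 hS.2, ?_⟩, insert_erase hS.2⟩
    rw [card_erase_of_mem hS.2, (mem_indepSetsIn.1 hS.1).2.1]
    rfl
  have heq := eq_of_subset_of_card_le hsub
    (card_image_le.trans ((card_powersetCard _ _).le.trans h))
  intro u hu w hw
  obtain ⟨S, hS₁, hS₂, hS₃⟩ := exists_subsuperset_card_eq (s := ({u, w} : Finset V).erase v) (t := W)
    (n := k + 2) (by
      intro a ha
      simp only [mem_erase, mem_insert, mem_singleton] at ha hu hw
      rcases ha with ⟨hav, rfl | rfl⟩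
      · exact hu.resolve_left hav
      · exact hw.resolve_left hav)
    ((card_erase_le.trans card_le_two).trans (by omega)) hk
  have hmem : insert v S ∈ {S ∈ G.indepSetsIn U (k + 3) | v ∈ S} := by
    rw [heq]
    exact mem_image_of_mem _ (mem_powersetCard.2 ⟨hS₂, hS₃⟩)
  have hind := (mem_indepSetsIn.1 (mem_filter.1 hmem).1).2.2
  have key : ∀ a ∈ ({u, w} : Finset V), a ∈ insert v S := by
    intro a ha
    by_cases hav : a = v
    · simp [hav]
    · exact mem_insert_of_mem (hS₁ (mem_erase.2 ⟨hav, ha⟩))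
  exact hind u (key u (by simp)) w (key w (by simp))

/-- The bound on independent sets in a union of `n`-cliques, with the equality case. -/
theorem card_indepSetsIn_biUnion_le {n k : ℕ} (hn : 1 ≤ n) (F : Finset (Finset V))
    (hF : ∀ A ∈ F, G.IsNClique n A) :
    #(G.indepSetsIn (F.biUnion id) (k + 3)) ≤ (#(F.biUnion id) + 1 - n).choose (k + 3) ∧
    (k + 3 ≤ #(F.biUnion id) + 1 - n →
      #(G.indepSetsIn (F.biUnion id) (k + 3)) = (#(F.biUnion id) + 1 - n).choose (k + 3) →
      ∃ I : Finset V, #I = #(F.biUnion id) + 1 - n ∧ ∀ u ∈ I, ∀ w ∈ I, ¬ G.Adj u w) := by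
  induction hs : #F using Nat.strong_induction_on generalizing F with
  | _ s ih =>
  subst hs
  rcases F.eq_empty_or_nonempty with rfl | hne
  · constructor
    · refine (card_indepSetsIn_le_choose _ _).trans ?_
      simp
    · simp
      omega
  · obtain ⟨A, hA, hmin⟩ := exists_min_image F (fun A ↦ #(A \ (F.erase A).biUnion id)) hne
    have ihA := ih _ (card_erase_lt_of_mem hA) (F.erase A)
      (fun B hB ↦ hF B (mem_of_mem_erase hB)) rfl
    set U := F.biUnion id with hU
    set U' := (F.erase A).biUnion id with hU'
    set P := A \ U' with hP
    have hUA : U = A ∪ U' := by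
      conv_lhs => rw [hU, ← insert_erase hA, biUnion_insert]
      rfl
    have hAU : A ⊆ U := hUA ▸ subset_union_left
    have hUP : U \ P = U' := by
      rw [hUA, hP]
      ext x
      simp only [mem_sdiff, mem_union]
      tauto
    have hPU : P ⊆ U := sdiff_subset.trans hAU
    have hcU' : #U' = #U - #P := by rw [← hUP, card_sdiff_of_subset hPU]
    have hAn : #A = n := (hF A hA).card_eq
    have hcW : #(U \ A) = #U - n := by rw [card_sdiff_of_subset hAU, hAn]
    have hnU : n ≤ #U := hAn ▸ card_le_card hAU
    by_cases hP0 : #P = 0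
    -- `A` is redundant: the smaller family has the same union.
    · rw [hP0, Nat.sub_zero] at hcU'
      have : U' = U := by rw [← hUP, card_eq_zero.1 hP0, sdiff_empty]
      rwa [this] at ihA
    · have hx : (k + 2) * #(G.indepSetsIn (U \ A) (k + 2)) ≤
          #(U \ A) * (#(U \ A) - #P).choose (k + 1) := by
        refine mul_card_indepSetsIn_le fun u hu ↦ ?_
        rw [mem_sdiff] at hu
        obtain ⟨B, hB, huB⟩ := mem_biUnion.1 hu.1
        have hBA : A ≠ B := by
          rintro rfl
          exact hu.2 huB
        -- `B \ A` contains the private part of `B`, which has at least `#P` vertices by the choice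
        -- of `A`.
        refine ⟨B \ A, sdiff_subset_sdiff (subset_biUnion_of_mem id hB) le_rfl,
          mem_sdiff.2 ⟨huB, hu.2⟩, (hmin B hB).trans (card_le_card ?_),
          (hF B hB).isClique.subset (by simp)⟩
        exact sdiff_subset_sdiff le_rfl (subset_biUnion_of_mem id (mem_erase.2 ⟨hBA, hA⟩))
      have harith := Nat.choose_add_mul_le_choose hx
      have hsum := card_indepSetsIn_le_add_sum (G := G) U P (k + 3)
      have hterm : ∀ v ∈ P, #{S ∈ G.indepSetsIn U (k + 3) | v ∈ S} ≤
          #(G.indepSetsIn (U \ A) (k + 2)) := fun v hv ↦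
        card_filter_mem_indepSetsIn_le (mem_sdiff.1 hv).1 (hF A hA).isClique
      have hsum' := sum_le_sum hterm
      rw [sum_const, smul_eq_mul] at hsum'
      rw [hUP] at hsum
      have hih := ihA.1
      rw [hcU', show #U - #P + 1 - n = #(U \ A) + 1 - #P by
        have := card_le_card hPU; omega] at hih
      rw [show #U + 1 - n = #(U \ A) + 1 by omega]
      refine ⟨by omega, fun hk heq ↦ ?_⟩
      have hP1 : #P = 1 := by
        by_contra hne1
        have := harith.2 (by omega) hk
        omega
      obtain ⟨v, hv⟩ := card_eq_one.1 hP1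
      have hvP : v ∈ P := by simp [hv]
      have hvA : v ∈ A := (mem_sdiff.1 hvP).1
      have hvW : v ∉ U \ A := fun h ↦ (mem_sdiff.1 h).2 hvA
      refine ⟨insert v (U \ A), card_insert_of_notMem hvW,
        indep_insert_of_choose_le (U := U) (k := k) (by omega) ?_ ?_⟩
      · intro S hS hvS u hu
        rw [mem_indepSetsIn] at hS
        rw [mem_erase] at hu
        exact mem_sdiff.2 ⟨hS.1 hu.2, fun huA ↦
          hS.2.2 v hvS u hu.2 ((hF A hA).isClique hvA huA hu.1.symm)⟩
      -- With `#P = 1`, Pascal's rule leaves at least `(#(U \ A)).choose (k + 2)` sets through `v`.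
      · rw [hv, sum_singleton, heq] at hsum
        have hpascal : (#(U \ A) + 1).choose (k + 3) =
            (#(U \ A)).choose (k + 2) + (#(U \ A)).choose (k + 3) := Nat.choose_succ_succ' _ _
        rw [hP1, Nat.add_sub_cancel] at hih
        omega

/-! ### From clique unions to the whole graph -/

variable [Fintype V]

theorem indepCount_eq_card_indepSetsIn (t : ℕ) :
    G.indepCount t = #(G.indepSetsIn univ t) := by
  unfold indepCount
  congr 1
  ext S
  simp only [mem_indepSetFinset_iff, isNIndepSet_iff, mem_indepSetsIn, subset_univ, true_and]
  rw [and_comm, and_congr_right_iff]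
  refine fun _ ↦ ⟨fun h u hu w hw huw ↦ h hu hw huw.ne huw, fun h u hu w hw _ ↦ h u hu w hw⟩

theorem card_indepSetsIn_univ_of_adj_iff {t : ℕ} (ht : 2 ≤ t) {I : Finset V}
    (hadj : ∀ u w, G.Adj u w ↔ u ≠ w ∧ ¬ (u ∈ I ∧ w ∈ I)) :
    #(G.indepSetsIn univ t) = (#I).choose t := by
  rw [← card_powersetCard]
  congr 1
  ext S
  simp only [mem_indepSetsIn, subset_univ, true_and, mem_powersetCard]
  refine ⟨fun ⟨hc, h⟩ ↦ ⟨fun u hu ↦ ?_, hc⟩, fun ⟨hSI, hc⟩ ↦ ⟨hc, fun u hu w hw h ↦ ?_⟩⟩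
  · obtain ⟨w, hw, hwu⟩ := exists_mem_ne (by omega : 1 < #S) u
    by_contra huI
    exact h u hu w hw ((hadj u w).2 ⟨hwu.symm, fun h ↦ huI h.1⟩)
  · exact ((hadj u w).1 h).2 ⟨hSI hu, hSI hw⟩

end SimpleGraph

theorem theorem1 (n t N : ℕ) (hn : 1 ≤ n) (ht : 3 ≤ t) (hN : n ≤ N)
    {V : Type*} [Fintype V] [DecidableEq V] (G : SimpleGraph V) [DecidableRel G.Adj]
    (hV : Fintype.card V = N) :
    (G.IsCoveredBy (SimpleGraph.completeGraph (Fin n)) →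
      G.indepCount t ≤ (N - n + 1).choose t) ∧
    (n + t - 1 ≤ N →
      ((G.IsCoveredBy (SimpleGraph.completeGraph (Fin n)) ∧
          G.indepCount t = (N - n + 1).choose t) ↔
        Nonempty (G ≃g SimpleGraph.splitGraph N (n - 1)))) := by
  obtain ⟨k, rfl⟩ : ∃ k, t = k + 3 := ⟨t - 3, by omega⟩
  subst hV
  rw [SimpleGraph.isCoveredBy_completeGraph_iff, SimpleGraph.indepCount_eq_card_indepSetsIn,
    SimpleGraph.nonempty_iso_splitGraph_iff (by omega)]
  have hcard : Fintype.card V + 1 - n = Fintype.card V - n + 1 := by omega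
  have main := SimpleGraph.card_indepSetsIn_biUnion_le (G := G) (k := k) hn (G.cliqueFinset n)
    (fun A hA ↦ (SimpleGraph.mem_cliqueFinset_iff).1 hA)
  have hU (hcov : ∀ v, ∃ A : Finset V, v ∈ A ∧ G.IsNClique n A) :
      (G.cliqueFinset n).biUnion id = Finset.univ := by
    refine Finset.eq_univ_of_forall fun v ↦ ?_
    obtain ⟨A, hvA, hA⟩ := hcov v
    exact Finset.mem_biUnion.2 ⟨A, SimpleGraph.mem_cliqueFinset_iff.2 hA, hvA⟩
  refine ⟨fun hcov ↦ ?_, fun hNt ↦ ⟨?_, ?_⟩⟩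
  · rw [hU hcov, Finset.card_univ, hcard] at main
    exact main.1
  · rintro ⟨hcov, heq⟩
    rw [hU hcov, Finset.card_univ, hcard] at main
    obtain ⟨I, hI, hind⟩ := main.2 (by omega) heq
    clear main
    have hI₁ : I.card + n = Fintype.card V + 1 := by omega
    have hI₂ : I.card = Fintype.card V - (n - 1) := by omega
    have hne : I.Nonempty := Finset.card_pos.1 (hI ▸ Nat.succ_pos _)
    exact ⟨I, hI₂, SimpleGraph.adj_iff_of_indep hcov hI₁ hind hne⟩
  · rintro ⟨I, hI, hadj⟩
    clear main
    have hI₁ : I.card + n = Fintype.card V + 1 := by omega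
    have hI₂ : I.card = Fintype.card V - n + 1 := by omega
    have hne : I.Nonempty := Finset.card_pos.1 (hI₂ ▸ Nat.succ_pos _)
    refine ⟨SimpleGraph.exists_isNClique_of_adj_iff hI₁ hne hadj, ?_⟩
    rw [SimpleGraph.card_indepSetsIn_univ_of_adj_iff (by omega) hadj, hI₂]
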